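/- **Definitions.** For a finite family $\mathcal F$ of subsets of $\mathbb R^d$, the dual hypergraph $H$ has the members of $\mathcal F$ as vertices and the sets $e_x=\{B\in\mathcal F: x\in B\}$, $x\in\mathbb R^d$, as hyperedges. For a set $S$ of vertices of a hypergraph $H=(V,\mathcal E)$, the induced subhypergraph is $H|_S=(S,\{e\cap S: e\in\mathcal E\})$. The Delaunay graph of a hypergraph is the graph on its vertex set whose edges are the hyperedges of cardinality $2$. For $c>0$, $H$ admits a hereditarily $c$-linear Delaunay graph if for every nonempty finite $S\subseteq V$ the Delaunay graph of $H|_S$ has fewer than $c|S|$ edges. A family has the $(p,2)$-property if among any $p$ of its members some two have a common point. A transversal of $\mathcal F$ is a set of points that meets every member of $\mathcal F$. **Theorem 2.** For every $c>0$ there is a constant $C>0$, depending only on $c$, such that the following holds for all integers $d\ge 0$ and $p\ge 2$. Let $\mathcal F$ be a finite family of nonempty subsets (regions) of $\mathbb R^d$ whose dual hypergraph admits a hereditarily $c$-linear Delaunay graph. If $\mathcal F$ has the $(p,2)$-property, then $\mathcal F$ has a transversal of at most $C\,p\log p$ points. -/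

import Mathlib

namespace Hypergraph

/-- The subhypergraph `H|_S` induced by a set `S` of vertices: its vertex set is `S` (intersected
with the vertex set of `H`), its hyperedges are the traces `e ∩ S` of the hyperedges `e` of `H`. -/
def inducedOn {α : Type*} (H : Hypergraph α) (S : Set α) : Hypergraph α where
  vertexSet := H.vertexSet ∩ S
  edgeSet := {t | ∃ e ∈ H.edgeSet, t = e ∩ S}
  subset_vertexSet_of_mem_edgeSet' := by
    rintro t ⟨e, he, rfl⟩
    exact Set.inter_subset_inter_left S (H.subset_vertexSet_of_mem_edgeSet' he)

/-- The Delaunay graph of a hypergraph `H`: the graph on the vertex set of `H` whose edges are the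
hyperedges of `H` of cardinality two. -/
def delaunayGraph {α : Type*} (H : Hypergraph α) : SimpleGraph H.vertexSet where
  Adj u v := u ≠ v ∧ ({u.1, v.1} : Set α) ∈ H.edgeSet
  symm := ⟨fun u v h => ⟨h.1.symm, Set.pair_comm u.1 v.1 ▸ h.2⟩⟩
  loopless := ⟨fun _ h => h.1 rfl⟩

/-- `H` admits a hereditarily `c`-linear Delaunay graph: for every nonempty finite set `S` of
vertices, the Delaunay graph of `H|_S` has fewer than `c * |S|` edges. -/
def HasHereditarilyLinearDelaunay {α : Type*} (H : Hypergraph α) (c : ℝ) : Prop :=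
  ∀ S : Finset α, S.Nonempty → (S : Set α) ⊆ H.vertexSet →
    ((H.inducedOn S).delaunayGraph.edgeSet.ncard : ℝ) < c * (S.card : ℝ)

end Hypergraph

/-- The dual hypergraph of a finite family `F` of subsets of `X`: its vertices are the members of
`F`, and every point `x` of `X` gives the hyperedge `{B ∈ F | x ∈ B}`. -/
def dualHypergraph {X : Type*} (F : Finset (Set X)) : Hypergraph (Set X) where
  vertexSet := F
  edgeSet := Set.range fun x : X => {B : Set X | B ∈ F ∧ x ∈ B}
  subset_vertexSet_of_mem_edgeSet' := by
    rintro e ⟨x, rfl⟩ B hB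
    exact hB.1

/-- The `(p, q)`-property: among any `p` members of `F`, some `q` have a common point. -/
def HasPQProperty {X : Type*} (F : Finset (Set X)) (p q : ℕ) : Prop :=
  ∀ G : Finset (Set X), G ⊆ F → G.card = p →
    ∃ I : Finset (Set X), I ⊆ G ∧ I.card = q ∧ ∃ x : X, ∀ A ∈ I, x ∈ A

/-- `Q` is a transversal of `F` (it pierces `F`): every member of `F` contains a point of `Q`. -/
def IsTransversal {X : Type*} (Q : Finset X) (F : Finset (Set X)) : Prop :=
  ∀ A ∈ F, ∃ x ∈ Q, x ∈ A

/-! The bound comes from rounding a fractional transversal. Suppose the regions carry weights of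
depth at most 1/2 at every point. In a random subfamily, a meeting pair becomes a Delaunay edge with
at least half the probability that both members are chosen, so hereditary linearity bounds the total
weight of meeting pairs (`sum_meeting_pairs_le`). The (p,2)-property makes that weight large, by
weighted Turán. Hence every weighting has a point carrying at least a 1/((8c+1)p) fraction of it
(`exists_deep_point`), and duality gives a probability distribution on points under which every
region has mass of order 1/p.

The regions also have VC-dimension bounded in terms of c: many shattered points would yield n
regions with a complete Delaunay graph (`card_lt_of_shatters`). The ε-net theorem, with ε of order
1/p, therefore replaces the distribution by O(p log p) points. -/

/-! ### Weighted Turán inequality -/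

open Finset in
/-- A weighted form of Turán's theorem: if `r` has no independent set of `k + 1` elements in `F`,
then the pairs related by `r` carry at least a `1 / k` fraction of the total weight. -/
theorem sq_sum_le_mul_sum_related {V : Type*} {r : V → V → Prop} [DecidableRel r]
    (hrefl : ∀ a, r a a) (hsymm : ∀ a b, r a b → r b a) {w : V → ℝ} (k : ℕ) (F : Finset V)
    (hw : ∀ a ∈ F, 0 ≤ w a)
    (hF : ∀ G ⊆ F, G.card = k + 1 → ∃ a ∈ G, ∃ b ∈ G, a ≠ b ∧ r a b) :
    (∑ a ∈ F, w a) ^ 2 ≤ k * ∑ a ∈ F, w a * ∑ b ∈ F with r a b, w b := by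
  classical
  induction k generalizing F with
  | zero =>
    have : F = ∅ := by
      by_contra hne
      obtain ⟨a, ha⟩ := nonempty_iff_ne_empty.2 hne
      obtain ⟨x, hx, y, hy, hxy, -⟩ := hF {a} (by simpa using ha) (by simp)
      simp only [mem_singleton] at hx hy
      exact hxy (hx.trans hy.symm)
    simp [this]
  | succ k ih =>
    rcases F.eq_empty_or_nonempty with rfl | hne
    · simp
    -- With the least neighbourhood weight D chosen, the neighbours of `a` contribute at least D².
    -- The non-neighbours have no independent set of k + 1 elements, since `a` could be added to it.
    obtain ⟨a, haF, hmin⟩ := exists_min_image F (fun a => ∑ b ∈ F with r a b, w b) hne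
    set D := ∑ b ∈ F with r a b, w b with hD
    set F' := F.filter (fun b => ¬ r a b) with hF'
    have hsub : F' ⊆ F := filter_subset _ _
    have hV := ih F' (fun b hb => hw b (hsub hb)) (fun G hG hcard => by
      have haG : a ∉ G := fun h => (mem_filter.1 (hG h)).2 (hrefl a)
      obtain ⟨x, hx, y, hy, hxy, hr⟩ := hF (insert a G)
        (insert_subset haF (hG.trans hsub)) (by rw [card_insert_of_notMem haG, hcard])
      rcases mem_insert.1 hx with rfl | hx'
      · rcases mem_insert.1 hy with rfl | hy'
        · exact absurd rfl hxy
        · exact absurd hr (mem_filter.1 (hG hy')).2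
      · rcases mem_insert.1 hy with rfl | hy'
        · exact absurd (hsymm _ _ hr) (mem_filter.1 (hG hx')).2
        · exact ⟨x, hx', y, hy', hxy, hr⟩)
    set V := ∑ b ∈ F', w b
    set Q' := ∑ b ∈ F', w b * ∑ b' ∈ F' with r b b', w b'
    have hQ'0 : 0 ≤ Q' := sum_nonneg fun b hb => mul_nonneg (hw b (hsub hb))
      (sum_nonneg fun b' hb' => hw b' (hsub (mem_filter.1 hb').1))
    have hsum : ∑ b ∈ F, w b = D + V := (sum_filter_add_sum_filter_not F (r a) w).symm
    have hQ : D ^ 2 + Q' ≤ ∑ b ∈ F, w b * ∑ b' ∈ F with r b b', w b' := by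
      rw [← sum_filter_add_sum_filter_not F (r a)]
      refine add_le_add ?_ ?_
      · rw [sq, hD, sum_mul]
        refine sum_le_sum fun b hb => mul_le_mul_of_nonneg_left ?_ (hw b (mem_filter.1 hb).1)
        exact hmin b (mem_filter.1 hb).1
      · refine sum_le_sum fun b hb => mul_le_mul_of_nonneg_left ?_ (hw b (mem_filter.1 hb).1)
        exact sum_le_sum_of_subset_of_nonneg (filter_subset_filter _ hsub)
          fun i hi _ => hw i (mem_filter.1 hi).1
    rw [hsum]
    refine le_trans ?_ (mul_le_mul_of_nonneg_left hQ (by positivity))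
    push_cast
    -- The cross term obeys 2kDV ≤ (kD)² + V² ≤ k(kD² + Q'). Cancelling k needs k > 0; for k = 0 the
    -- induction hypothesis gives V = 0.
    rcases Nat.eq_zero_or_pos k with rfl | hk
    · have : V = 0 := by
        have : V ^ 2 ≤ 0 := by simpa using hV
        exact pow_eq_zero_iff two_ne_zero |>.1 (le_antisymm this (sq_nonneg _))
      rw [this]
      simp only [Nat.cast_zero]
      nlinarith
    · have hk' : (0 : ℝ) < k := by exact_mod_cast hk
      have h1 : k * (2 * D * V) ≤ k * (k * D ^ 2 + Q') := by
        nlinarith [sq_nonneg (k * D - V)]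
      have h2 := le_of_mul_le_mul_left h1 hk'
      nlinarith

/-! ### Independent random subsets -/

open Finset in
/-- In a random subset of `F` that contains each `a` independently with probability `q a`, the
trace on `E` is `T` with probability `∏ a ∈ T, q a * ∏ a ∈ E \ T, (1 - q a)`. -/
theorem sum_powerset_inter_eq {V : Type*} [DecidableEq V] (q : V → ℝ) {F E T : Finset V}
    (hE : E ⊆ F) (hT : T ⊆ E) :
    (∑ S ∈ F.powerset, if S ∩ E = T then (∏ a ∈ S, q a) * ∏ a ∈ F \ S, (1 - q a) else 0) =
      (∏ a ∈ T, q a) * ∏ a ∈ E \ T, (1 - q a) := by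
  -- Zeroing q on E \ T and 1 - q on T kills exactly the terms of the expansion with S ∩ E ≠ T.
  have key := prod_add (fun a => if a ∈ E \ T then 0 else q a)
    (fun a => if a ∈ T then 0 else 1 - q a) F
  have hR : ∏ a ∈ F, ((if a ∈ E \ T then 0 else q a) + (if a ∈ T then 0 else 1 - q a)) =
      (∏ a ∈ T, q a) * ∏ a ∈ E \ T, (1 - q a) := by
    rw [← prod_sdiff hE, ← prod_sdiff hT, prod_eq_one (s := F \ E), one_mul, mul_comm]
    · congr 1
      · exact prod_congr rfl fun a ha => by simp [ha]
      · exact prod_congr rfl fun a ha => by simp [ha, (mem_sdiff.1 ha).2]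
    · intro a ha
      have h1 := (mem_sdiff.1 ha).2
      have h2 : a ∉ T := fun h => h1 (hT h)
      simp [h1, h2]
  rw [← hR, key]
  refine sum_congr rfl fun S hS => ?_
  have hSF := mem_powerset.1 hS
  split_ifs with h
  · congr 1
    · refine prod_congr rfl fun a ha => (if_neg ?_).symm
      intro h'
      rw [← h] at h'
      simp [ha] at h'
    · refine prod_congr rfl fun a ha => (if_neg ?_).symm
      intro h'
      rw [← h] at h'
      exact (mem_sdiff.1 ha).2 (mem_inter.1 h').1
  · by_cases h1 : ∃ a ∈ S, a ∈ E \ T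
    · obtain ⟨a, ha, ha'⟩ := h1
      rw [prod_eq_zero ha (by simp only [ha', if_true]), zero_mul]
    · have h2 : ∃ a ∈ F \ S, a ∈ T := by
        by_contra h2
        push Not at h1 h2
        apply h
        ext a
        have := h1 a; have := h2 a; have := @hT a; have := @hE a
        simp only [mem_inter, mem_sdiff] at *
        tauto
      obtain ⟨a, ha, ha'⟩ := h2
      rw [prod_eq_zero ha (by simp only [ha', if_true]), mul_zero]

open Finset in
theorem one_sub_sum_le_prod_one_sub {V : Type*} [DecidableEq V] (q : V → ℝ) (s : Finset V)
    (h0 : ∀ a ∈ s, 0 ≤ q a) (h1 : ∀ a ∈ s, q a ≤ 1) :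
    1 - ∑ a ∈ s, q a ≤ ∏ a ∈ s, (1 - q a) := by
  induction s using Finset.induction_on with
  | empty => simp
  | insert a s ha ih =>
    rw [sum_insert ha, prod_insert ha]
    have ih := ih (fun b hb => h0 b (mem_insert_of_mem hb)) (fun b hb => h1 b (mem_insert_of_mem hb))
    have ha0 := h0 a (mem_insert_self _ _)
    have ha1 := h1 a (mem_insert_self _ _)
    have hs : 0 ≤ ∑ a ∈ s, q a := sum_nonneg fun b hb => h0 b (mem_insert_of_mem hb)
    nlinarith [mul_le_mul_of_nonneg_left ih (sub_nonneg.2 ha1)]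

/-! ### Duality for matrix games -/

/-- Linear programming duality for a matrix game: if every nonnegative weighting of the columns
leaves some row with at least a `δ` fraction of the total weight, then some probability
distribution on the rows gives value at least `δ` to every column. -/
theorem exists_stdSimplex_forall_le {ι κ : Type*} [Fintype ι] [Fintype κ] (M : ι → κ → ℝ) (δ : ℝ)
    (h : ∀ w : κ → ℝ, (∀ j, 0 ≤ w j) → ∃ i, δ * ∑ j, w j ≤ ∑ j, w j * M i j) :
    ∃ μ ∈ stdSimplex ℝ ι, ∀ j, δ ≤ ∑ i, μ i * M i j := by
  classical
  let L : (ι → ℝ) →ₗ[ℝ] (κ → ℝ) :=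
    { toFun := fun μ j => ∑ i, μ i * M i j
      map_add' := fun μ ν => by ext j; simp [add_mul, Finset.sum_add_distrib]
      map_smul' := fun t μ => by ext j; simp [mul_assoc, Finset.mul_sum] }
  have hLc : Continuous L := L.continuous_of_finiteDimensional
  by_contra hcon
  push Not at hcon
  have hdisj : Disjoint (L '' stdSimplex ℝ ι) {v : κ → ℝ | ∀ j, δ ≤ v j} := by
    rw [Set.disjoint_left]
    rintro _ ⟨μ, hμ, rfl⟩ hv
    obtain ⟨j, hj⟩ := hcon μ hμ
    exact absurd (hv j) (not_le.2 hj)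
  have hconv : Convex ℝ {v : κ → ℝ | ∀ j, δ ≤ v j} := by
    have : {v : κ → ℝ | ∀ j, δ ≤ v j} = Set.Ici (fun _ => δ) := by
      ext v; simp [Pi.le_def]
    rw [this]
    exact convex_Ici _
  have hclosed : IsClosed {v : κ → ℝ | ∀ j, δ ≤ v j} := by
    have : {v : κ → ℝ | ∀ j, δ ≤ v j} = Set.Ici (fun _ => δ) := by
      ext v; simp [Pi.le_def]
    rw [this]
    exact isClosed_Ici
  -- The separating functional supplies the column weights that contradict `h`. They are nonnegative
  -- because the orthant is unbounded upwards.
  obtain ⟨f, u, v, hu, huv, hv⟩ := geometric_hahn_banach_compact_closed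
    ((convex_stdSimplex ℝ ι).linear_image L) ((isCompact_stdSimplex ℝ ι).image hLc)
    hconv hclosed hdisj
  have hf : ∀ x : κ → ℝ, f x = ∑ j, f (Pi.single j 1) * x j := by
    intro x
    conv_lhs => rw [← Finset.univ_sum_single x]
    rw [map_sum]
    refine Finset.sum_congr rfl fun j _ => ?_
    have : Pi.single j (x j) = x j • (Pi.single j (1 : ℝ) : κ → ℝ) := by
      rw [← Pi.single_smul]; simp
    rw [this, map_smul, smul_eq_mul, mul_comm]
  have hw : ∀ j, 0 ≤ f (Pi.single j 1) := by
    intro j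
    by_contra hneg
    push Not at hneg
    set b := f (fun _ => δ)
    have hb : v < b := hv _ (fun _ => le_rfl)
    -- Moving by t along coordinate j lowers f from b to exactly v, which the strict separation
    -- forbids.
    set t := (b - v) / (-f (Pi.single j 1)) with ht
    have ht0 : 0 ≤ t := div_nonneg (by linarith) (by linarith)
    have := hv ((fun _ => δ) + t • Pi.single j 1) (fun i => by
      by_cases hij : i = j
      · subst hij; simpa using ht0
      · simp [hij])
    rw [map_add, map_smul, smul_eq_mul, ht, div_mul_eq_mul_div,
      mul_div_assoc, div_neg, div_self hneg.ne] at this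
    linarith
  obtain ⟨i, hi⟩ := h _ hw
  have h1 := hu (L (Pi.single i 1)) ⟨_, single_mem_stdSimplex ℝ i, rfl⟩
  have h2 := hv (fun _ => δ) (fun _ => le_rfl)
  have hLi : L (Pi.single i 1) = M i := by
    ext j
    change ∑ i', (Pi.single i (1 : ℝ) : ι → ℝ) i' * M i' j = M i j
    simp [Pi.single_apply]
  rw [hLi, hf] at h1
  rw [hf, ← Finset.sum_mul] at h2
  linarith

/-! ### The ε-net theorem by double sampling -/

open Finset in
/-- The Sauer–Shelah bound: a family that shatters only sets of at most `D` elements has at most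
`(n + 1) ^ D` traces on a set of `n` elements. -/
theorem card_image_inter_le_pow {α : Type*} [DecidableEq α] (𝒜 : Finset (Finset α)) (D : ℕ)
    (h𝒜 : ∀ s, 𝒜.Shatters s → s.card ≤ D) (Z : Finset α) :
    (𝒜.image (· ∩ Z)).card ≤ (Z.card + 1) ^ D := by
  refine (card_le_card_shatterer _).trans ?_
  have hsub : (𝒜.image (· ∩ Z)).shatterer ⊆
      (range (D + 1)).biUnion fun i => powersetCard i Z := by
    intro s hs
    rw [mem_shatterer] at hs
    have hsZ : s ⊆ Z := by
      obtain ⟨t, ht, hst⟩ := hs.exists_superset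
      obtain ⟨A, -, rfl⟩ := mem_image.1 ht
      exact hst.trans inter_subset_right
    have hsA : 𝒜.Shatters s := by
      intro t ht
      obtain ⟨u, hu, hut⟩ := hs ht
      obtain ⟨A, hA, rfl⟩ := mem_image.1 hu
      refine ⟨A, hA, ?_⟩
      rw [← hut, inter_comm A Z, ← inter_assoc, inter_eq_left.2 hsZ]
    have := h𝒜 s hsA
    simp only [mem_biUnion, mem_range, mem_powersetCard]
    exact ⟨s.card, by lia, hsZ, rfl⟩
  refine (card_le_card hsub).trans (card_biUnion_le.trans ?_)
  -- Termwise comparison with the binomial expansion: choose n i ≤ n^i · choose D i for i ≤ D.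
  rw [add_pow]
  refine sum_le_sum fun i hi => ?_
  rw [card_powersetCard, one_pow, mul_one]
  calc Z.card.choose i ≤ Z.card ^ i := Nat.choose_le_pow _ _
    _ ≤ Z.card ^ i * D.choose i :=
      Nat.le_mul_of_pos_right _ (Nat.choose_pos (by simpa [Nat.lt_succ_iff] using hi))

open Finset in
/-- Double counting over random swaps of the coordinates of `z : Fin m → α × α`: the coordinate
swaps after which some member of `𝒜` misses all first entries and contains at least `k` of the
second entries make up at most a `(2 * m + 1) ^ D / 2 ^ k` fraction of all swaps. -/
theorem card_swaps_mul_two_pow_le {α : Type*} [DecidableEq α] (𝒜 : Finset (Finset α)) {D m k : ℕ}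
    (h𝒜 : ∀ s, 𝒜.Shatters s → s.card ≤ D) (z : Fin m → α × α) :
    (univ.filter fun σ : Fin m → Bool => ∃ A ∈ 𝒜,
      (∀ i, (bif σ i then (z i).swap else z i).1 ∉ A) ∧
      k ≤ (univ.filter fun i => (bif σ i then (z i).swap else z i).2 ∈ A).card).card * 2 ^ k ≤
      (2 * m + 1) ^ D * 2 ^ m := by
  classical
  set Z : Finset α := univ.image (fun i => (z i).1) ∪ univ.image (fun i => (z i).2) with hZ
  have hZc : Z.card ≤ 2 * m := by
    refine (card_union_le _ _).trans ?_
    have h1 := card_image_le (s := (univ : Finset (Fin m))) (f := fun i => (z i).1)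
    have h2 := card_image_le (s := (univ : Finset (Fin m))) (f := fun i => (z i).2)
    simp only [card_univ, Fintype.card_fin] at h1 h2
    lia
  have hz1 : ∀ (σ : Fin m → Bool) i, (bif σ i then (z i).swap else z i).1 ∈ Z := by
    intro σ i
    cases σ i <;> simp [hZ]
  have hz2 : ∀ (σ : Fin m → Bool) i, (bif σ i then (z i).swap else z i).2 ∈ Z := by
    intro σ i
    cases σ i <;> simp [hZ]
  have hone : ∀ T : Finset α, (univ.filter fun σ : Fin m → Bool =>
      (∀ i, (bif σ i then (z i).swap else z i).1 ∉ T) ∧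
      k ≤ (univ.filter fun i => (bif σ i then (z i).swap else z i).2 ∈ T).card).card * 2 ^ k ≤
      2 ^ m := by
    intro T
    -- The two orders of a pair have total weight at most 2: it is 0 + 0, 0 + 2 or 1 + 1 as two, one
    -- or none of the entries lie in T. A counted swap has product at least 2^k.
    let g : Fin m → Bool → ℕ := fun i b =>
      if (bif b then (z i).swap else z i).1 ∈ T then 0 else
        if (bif b then (z i).swap else z i).2 ∈ T then 2 else 1
    have hg : ∑ σ : Fin m → Bool, ∏ i, g i (σ i) ≤ 2 ^ m := by
      have := prod_univ_sum (fun _ : Fin m => (univ : Finset Bool)) g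
      rw [Fintype.piFinset_univ] at this
      rw [← this]
      calc ∏ i, ∑ b, g i b ≤ ∏ _i : Fin m, 2 := by
            refine prod_le_prod' fun i _ => ?_
            simp only [g, Fintype.sum_bool, cond_true, cond_false, Prod.fst_swap, Prod.snd_swap]
            split_ifs <;> simp
        _ = 2 ^ m := by simp
    refine le_trans ?_ hg
    rw [← smul_eq_mul, ← sum_const]
    refine (sum_le_sum fun σ hσ => ?_).trans (sum_le_sum_of_subset (filter_subset _ _))
    obtain ⟨-, h1, h2⟩ := mem_filter.1 hσ
    have : ∏ i, g i (σ i) =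
        ∏ i, if (bif σ i then (z i).swap else z i).2 ∈ T then 2 else 1 :=
      prod_congr rfl fun i _ => if_neg (h1 i)
    rw [this, prod_ite, prod_const, prod_const_one, mul_one]
    exact Nat.pow_le_pow_right two_pos h2
  calc _ ≤ ((𝒜.image (· ∩ Z)).biUnion fun T => univ.filter fun σ : Fin m → Bool =>
      (∀ i, (bif σ i then (z i).swap else z i).1 ∉ T) ∧
      k ≤ (univ.filter fun i => (bif σ i then (z i).swap else z i).2 ∈ T).card).card * 2 ^ k := by
        refine Nat.mul_le_mul_right _ (card_le_card fun σ hσ => ?_)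
        obtain ⟨-, A, hA, h1, h2⟩ := mem_filter.1 hσ
        refine mem_biUnion.2 ⟨A ∩ Z, mem_image_of_mem _ hA, mem_filter.2 ⟨mem_univ _, ?_, ?_⟩⟩
        · exact fun i h => h1 i (mem_inter.1 h).1
        · refine h2.trans (card_le_card fun i hi => ?_)
          rw [mem_filter] at hi ⊢
          exact ⟨hi.1, mem_inter.2 ⟨hi.2, hz2 σ i⟩⟩
    _ ≤ (∑ T ∈ 𝒜.image (· ∩ Z), (univ.filter fun σ : Fin m → Bool =>
      (∀ i, (bif σ i then (z i).swap else z i).1 ∉ T) ∧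
      k ≤ (univ.filter fun i => (bif σ i then (z i).swap else z i).2 ∈ T).card).card) * 2 ^ k :=
        Nat.mul_le_mul_right _ card_biUnion_le
    _ ≤ ∑ T ∈ 𝒜.image (· ∩ Z), 2 ^ m := by
        rw [sum_mul]
        exact sum_le_sum fun T _ => hone T
    _ = (𝒜.image (· ∩ Z)).card * 2 ^ m := by rw [sum_const, smul_eq_mul]
    _ ≤ (2 * m + 1) ^ D * 2 ^ m := by
        refine Nat.mul_le_mul_right _ ((card_image_inter_le_pow 𝒜 D h𝒜 Z).trans ?_)
        exact Nat.pow_le_pow_left (by lia) _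

open Finset in
/-- Exponential Markov bound: if `A` has mass at least `ε`, then `m` independent samples fall into
`A` fewer than `k` times with probability at most `2 ^ k * (1 - ε / 2) ^ m`. -/
theorem sum_prod_filter_card_lt_le {α : Type*} [Fintype α] [DecidableEq α] {μ : α → ℝ}
    (hμ : μ ∈ stdSimplex ℝ α) {A : Finset α} {ε : ℝ} (hA : ε ≤ ∑ a ∈ A, μ a) (m k : ℕ) :
    (∑ y : Fin m → α with (univ.filter fun i => y i ∈ A).card < k, ∏ i, μ (y i)) ≤
      2 ^ k * (1 - ε / 2) ^ m := by
  have hsum : ∑ a, μ a * (if a ∈ A then 1 / 2 else 1) = 1 - (∑ a ∈ A, μ a) / 2 := by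
    have h1 : ∀ a, μ a * (if a ∈ A then (1 : ℝ) / 2 else 1) =
        μ a - (if a ∈ A then μ a else 0) / 2 := by
      intro a; split_ifs <;> ring
    simp_rw [h1]
    rw [sum_sub_distrib, hμ.2, ← sum_div]
    simp
  have hle : ∑ a ∈ A, μ a ≤ 1 := by
    rw [← hμ.2]
    exact sum_le_sum_of_subset_of_nonneg (subset_univ _) fun a _ _ => hμ.1 a
  -- This is the expectation of 2^(-N), N being the number of hits in `A`; the variable exceeds
  -- 2^(-k) when N < k.
  have hpow : ∑ y : Fin m → α, ∏ i, μ (y i) * (if y i ∈ A then 1 / 2 else 1) =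
      (1 - (∑ a ∈ A, μ a) / 2) ^ m := by
    have := prod_univ_sum (fun _ : Fin m => (univ : Finset α))
      (fun _ a => μ a * (if a ∈ A then (1 : ℝ) / 2 else 1))
    rw [Fintype.piFinset_univ, hsum, prod_const, card_univ, Fintype.card_fin] at this
    exact this.symm
  calc _ ≤ ∑ y : Fin m → α with (univ.filter fun i => y i ∈ A).card < k,
        2 ^ k * ∏ i, μ (y i) * (if y i ∈ A then 1 / 2 else 1) := by
        refine sum_le_sum fun y hy => ?_
        have hy := (mem_filter.1 hy).2
        have hp : 0 ≤ ∏ i, μ (y i) := prod_nonneg fun i _ => hμ.1 _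
        rw [prod_mul_distrib, prod_ite, prod_const, prod_const_one, mul_one, mul_left_comm]
        refine le_mul_of_one_le_right hp ?_
        rw [one_div, inv_pow, ← div_eq_mul_inv, one_le_div (by positivity)]
        exact pow_le_pow_right₀ one_le_two hy.le
    _ ≤ ∑ y : Fin m → α, 2 ^ k * ∏ i, μ (y i) * (if y i ∈ A then 1 / 2 else 1) :=
        sum_le_sum_of_subset_of_nonneg (filter_subset _ _) fun y _ _ =>
          mul_nonneg (by positivity) (prod_nonneg fun i _ => mul_nonneg (hμ.1 _)
            (by split_ifs <;> norm_num))
    _ = 2 ^ k * (1 - (∑ a ∈ A, μ a) / 2) ^ m := by rw [← mul_sum, hpow]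
    _ ≤ 2 ^ k * (1 - ε / 2) ^ m := by
        gcongr
        linarith

open Finset in
/-- The `ε`-net theorem, by double sampling: a family of sets of mass at least `ε` that shatters
only sets of at most `D` elements is met by `m` points, where `m` is large enough. -/
theorem exists_net_of_shatters_card_le {α : Type*} [Fintype α] [DecidableEq α]
    (𝒜 : Finset (Finset α)) {D m k : ℕ} (h𝒜 : ∀ s, 𝒜.Shatters s → s.card ≤ D) {μ : α → ℝ}
    (hμ : μ ∈ stdSimplex ℝ α) {ε : ℝ} (hε : ∀ A ∈ 𝒜, ε ≤ ∑ a ∈ A, μ a)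
    (hm : 2 * (2 ^ k * (1 - ε / 2) ^ m) ≤ 1) (hk : 2 * (2 * m + 1) ^ D < 2 ^ k) :
    ∃ x : Fin m → α, ∀ A ∈ 𝒜, ∃ i, x i ∈ A := by
  classical
  by_contra hcon
  push Not at hcon
  choose B hB𝒜 hB using hcon
  obtain ⟨bad, hbad⟩ : ∃ bad : (Fin m → α × α) → Prop, ∀ z, bad z ↔ ∃ A ∈ 𝒜,
      (∀ i, (z i).1 ∉ A) ∧ k ≤ (univ.filter fun i => (z i).2 ∈ A).card := ⟨_, fun _ => Iff.rfl⟩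
  let V : (Fin m → α × α) → ℝ := fun z => ∏ i, μ (z i).1 * μ (z i).2
  have hV0 : ∀ z, 0 ≤ V z := fun z => prod_nonneg fun i _ => mul_nonneg (hμ.1 _) (hμ.1 _)
  have hW : ∑ y : Fin m → α, ∏ i, μ (y i) = 1 := by
    have := prod_univ_sum (fun _ : Fin m => (univ : Finset α)) (fun _ a => μ a)
    rw [Fintype.piFinset_univ, hμ.2, prod_const_one] at this
    exact this.symm
  have hsplit : ∀ f : (Fin m → α × α) → ℝ, ∑ z, f z =
      ∑ x : Fin m → α, ∑ y : Fin m → α, f fun i => (x i, y i) := by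
    intro f
    rw [← Fintype.sum_prod_type']
    exact Fintype.sum_equiv (Equiv.arrowProdEquivProdArrow (Fin m) (fun _ => α) (fun _ => α)) _ _
      fun z => rfl
  have hV1 : ∑ z, V z = 1 := by
    rw [hsplit]
    simp only [V, prod_mul_distrib]
    simp_rw [← mul_sum, hW, mul_one]
    exact hW
  -- By `hm`, for each x the second sample hits the missed set `B x` at least k times with
  -- probability at least 1/2.
  have hlow : 1 ≤ 2 * ∑ z, (if bad z then V z else 0) := by
    rw [hsplit]
    have hx : ∀ x : Fin m → α, ∏ i, μ (x i) ≤
        2 * ∑ y : Fin m → α, (if bad (fun i => (x i, y i)) then V fun i => (x i, y i) else 0) := by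
      intro x
      have hxp : 0 ≤ ∏ i, μ (x i) := prod_nonneg fun i _ => hμ.1 _
      have h1 := sum_prod_filter_card_lt_le hμ (hε _ (hB𝒜 x)) m k
      have h2 := sum_filter_add_sum_filter_not univ
        (fun y : Fin m → α => (univ.filter fun i => y i ∈ B x).card < k) fun y => ∏ i, μ (y i)
      rw [hW] at h2
      have h3 : (∏ i, μ (x i)) * ∑ y : Fin m → α with
          ¬ (univ.filter fun i => y i ∈ B x).card < k, ∏ i, μ (y i) ≤
          ∑ y : Fin m → α, (if bad (fun i => (x i, y i)) then V fun i => (x i, y i) else 0) := by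
        rw [mul_sum, ← sum_filter]
        refine (sum_le_sum_of_subset_of_nonneg (t := univ.filter fun y => bad fun i => (x i, y i))
          (fun y hy => ?_) fun y _ _ => ?_).trans (sum_le_sum fun y _ => ?_)
        · refine mem_filter.2 ⟨mem_univ _, (hbad _).2 ⟨B x, hB𝒜 x, hB x, ?_⟩⟩
          exact not_lt.1 (mem_filter.1 hy).2
        · exact mul_nonneg hxp (prod_nonneg fun i _ => hμ.1 _)
        · exact (prod_mul_distrib (f := fun i => μ (x i)) (g := fun i => μ (y i))).ge
      nlinarith
    calc (1 : ℝ) = ∑ x : Fin m → α, ∏ i, μ (x i) := hW.symm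
      _ ≤ _ := by
        rw [mul_sum]
        exact sum_le_sum fun x _ => hx x
  -- Both entries of a pair have the same law, so the bad event may be averaged over all swaps; for
  -- fixed z the combinatorial count then applies.
  have hswap : ∀ σ : Fin m → Bool, ∑ z, (if bad z then V z else 0) =
      ∑ z, (if bad (fun i => bif σ i then (z i).swap else z i) then V z else 0) := by
    intro σ
    let e : (Fin m → α × α) ≃ (Fin m → α × α) := Function.Involutive.toPerm
      (fun z i => bif σ i then (z i).swap else z i) (fun z => by
        funext i
        simp only
        cases σ i <;> simp)
    refine (Fintype.sum_equiv e _ _ fun z => ?_).symm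
    have : V (e z) = V z := by
      refine prod_congr rfl fun i _ => ?_
      change μ (bif σ i then (z i).swap else z i).1 * μ (bif σ i then (z i).swap else z i).2 = _
      cases σ i
      · rfl
      · exact mul_comm _ _
    rw [this]
    rfl
  have hup : (2 : ℝ) ^ m * ∑ z, (if bad z then V z else 0) * 2 ^ k ≤
      (2 * m + 1) ^ D * 2 ^ m := by
    calc (2 : ℝ) ^ m * ∑ z, (if bad z then V z else 0) * 2 ^ k
        = ∑ σ : Fin m → Bool, ∑ z,
          (if bad (fun i => bif σ i then (z i).swap else z i) then V z else 0) * 2 ^ k := by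
          simp_rw [← sum_mul, ← hswap]
          simp [mul_assoc]
      _ = ∑ z, V z * (((univ.filter fun σ : Fin m → Bool =>
          bad (fun i => bif σ i then (z i).swap else z i)).card : ℝ) * 2 ^ k) := by
          rw [sum_comm]
          refine sum_congr rfl fun z _ => ?_
          rw [← sum_mul, ← sum_filter, sum_const, nsmul_eq_mul]
          ring
      _ ≤ ∑ z, V z * ((2 * m + 1) ^ D * 2 ^ m) := by
          refine sum_le_sum fun z _ => mul_le_mul_of_nonneg_left ?_ (hV0 z)
          simp_rw [hbad]
          exact_mod_cast card_swaps_mul_two_pow_le 𝒜 h𝒜 z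
      _ = (2 * m + 1) ^ D * 2 ^ m := by rw [← sum_mul, hV1, one_mul]
  have hk' : (2 * (2 * m + 1) ^ D : ℝ) < 2 ^ k := by exact_mod_cast hk
  rw [← sum_mul, mul_comm ((2 * (m : ℝ) + 1) ^ D)] at hup
  have h2 := le_of_mul_le_mul_left hup (by positivity)
  have h3 : (0 : ℝ) < 2 ^ k := by positivity
  nlinarith

/-! ### Delaunay edges, meeting pairs and deep points -/

-- Ordered pairs count each edge twice, hence the factor 2. The inequality is not strict so that an
-- empty random sample is covered.
open Finset in
open scoped Classical in
theorem card_delaunay_pairs_le {X : Type*} {F : Finset (Set X)} {c : ℝ}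
    (hF : (dualHypergraph F).HasHereditarilyLinearDelaunay c) {S : Finset (Set X)} (hS : S ⊆ F) :
    ((S.offDiag.filter fun e => ∃ x, (S.filter fun A => x ∈ A) = {e.1, e.2}).card : ℝ) ≤
      2 * c * S.card := by
  rcases S.eq_empty_or_nonempty with rfl | hne
  · simp
  have h := hF S hne (by simpa [dualHypergraph] using hS)
  set G := ((dualHypergraph F).inducedOn S).delaunayGraph with hG
  have hfin : Finite ((dualHypergraph F).inducedOn S).vertexSet :=
    Set.Finite.subset (s := (S : Set (Set X))) S.finite_toSet Set.inter_subset_right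
  have hEfin : (Sym2.map Subtype.val '' G.edgeSet).Finite := (Set.toFinite _).image _
  have hncard : (Sym2.map Subtype.val '' G.edgeSet).ncard = G.edgeSet.ncard :=
    Set.ncard_image_of_injective _ (Sym2.map.injective Subtype.val_injective)
  set P := S.offDiag.filter fun e => ∃ x, (S.filter fun A => x ∈ A) = {e.1, e.2} with hP
  have h1 : P.card ≤ 2 * (P.image fun e => s(e.1, e.2)).card := by
    refine card_le_mul_card_image P 2 fun b _ => ?_
    induction b with | _ a b =>
    refine (card_le_card (t := {(a, b), (b, a)}) fun e he => ?_).trans card_le_two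
    have := (mem_filter.1 he).2
    rw [Sym2.eq_iff] at this
    simp only [mem_insert, mem_singleton, Prod.ext_iff]
    exact this
  have h2 : (P.image fun e => s(e.1, e.2)).card ≤ G.edgeSet.ncard := by
    rw [← hncard, ← Set.ncard_coe_finset]
    refine Set.ncard_le_ncard (fun s hs => ?_) hEfin
    obtain ⟨e, he, rfl⟩ := mem_image.1 (mem_coe.1 hs)
    obtain ⟨heS, x, hx⟩ := mem_filter.1 he
    obtain ⟨ha, hb, hab⟩ := mem_offDiag.1 heS
    refine ⟨s(⟨e.1, hS ha, ha⟩, ⟨e.2, hS hb, hb⟩), ?_, rfl⟩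
    rw [SimpleGraph.mem_edgeSet]
    refine ⟨fun h => hab (congrArg Subtype.val h), _, ⟨x, rfl⟩, ?_⟩
    ext A
    have := Finset.ext_iff.1 hx A
    have := @hS A
    simp only [mem_filter, mem_insert, mem_singleton] at *
    simp only [Set.mem_insert_iff, Set.mem_singleton_iff, Set.mem_inter_iff, Set.mem_ofPred_eq,
      mem_coe]
    tauto
  have h3 : (P.card : ℝ) ≤ 2 * G.edgeSet.ncard := by exact_mod_cast h1.trans (by lia)
  linarith

open Finset in
open scoped Classical in
/-- A Clarkson–Shor bound: for sampling probabilities `q` of depth at most `1 / 2` everywhere, the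
pairs of distinct meeting members carry weight at most `4 * c * ∑ A ∈ F, q A`. -/
theorem sum_meeting_pairs_le {X : Type*} {F : Finset (Set X)} {c : ℝ}
    (hF : (dualHypergraph F).HasHereditarilyLinearDelaunay c) (hne : ∀ A ∈ F, A.Nonempty)
    {q : Set X → ℝ} (hq : ∀ A ∈ F, 0 ≤ q A)
    (hdepth : ∀ x, ∑ A ∈ F with x ∈ A, q A ≤ 1 / 2) :
    ∑ e ∈ F.offDiag with (e.1 ∩ e.2).Nonempty, q e.1 * q e.2 ≤ 4 * c * ∑ A ∈ F, q A := by
  have hq1 : ∀ A ∈ F, q A ≤ 1 := by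
    intro A hA
    obtain ⟨x, hx⟩ := hne A hA
    have h1 := single_le_sum (f := q) (s := F.filter fun A => x ∈ A)
      (fun B hB => hq B (mem_filter.1 hB).1) (mem_filter.2 ⟨hA, hx⟩)
    linarith [hdepth x]
  let π : Finset (Set X) → ℝ := fun S => (∏ A ∈ S, q A) * ∏ A ∈ F \ S, (1 - q A)
  have hπ : ∀ S ∈ F.powerset, 0 ≤ π S := fun S hS =>
    mul_nonneg (prod_nonneg fun A hA => hq A (mem_powerset.1 hS hA))
      (prod_nonneg fun A hA => sub_nonneg.2 (hq1 A (mem_sdiff.1 hA).1))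
  let Del : Finset (Set X) → Finset (Set X × Set X) := fun S =>
    S.offDiag.filter fun e => ∃ x, (S.filter fun A => x ∈ A) = {e.1, e.2}
  -- If x lies in both members, the pair is a Delaunay edge of the sample as soon as both are chosen
  -- and no other region through x is. By the union bound the latter has probability at least 1/2.
  have hpair : ∀ e ∈ F.offDiag.filter fun e => (e.1 ∩ e.2).Nonempty,
      q e.1 * q e.2 ≤ 2 * ∑ S ∈ F.powerset, if e ∈ Del S then π S else 0 := by
    intro e he
    obtain ⟨heF, x, hx1, hx2⟩ := mem_filter.1 he
    obtain ⟨ha, hb, hab⟩ := mem_offDiag.1 heF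
    set E := F.filter fun A => x ∈ A with hE
    have hTE : ({e.1, e.2} : Finset (Set X)) ⊆ E := by
      intro A hA
      rcases mem_insert.1 hA with rfl | hA
      · exact mem_filter.2 ⟨ha, hx1⟩
      · rw [mem_singleton.1 hA]
        exact mem_filter.2 ⟨hb, hx2⟩
    have hEF : E ⊆ F := filter_subset _ _
    have h1 := sum_powerset_inter_eq q hEF hTE
    rw [prod_pair hab] at h1
    have h2 := one_sub_sum_le_prod_one_sub q (E \ {e.1, e.2})
      (fun A hA => hq A (hEF (mem_sdiff.1 hA).1)) (fun A hA => hq1 A (hEF (mem_sdiff.1 hA).1))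
    have h3 : ∑ A ∈ E \ {e.1, e.2}, q A ≤ 1 / 2 :=
      (sum_le_sum_of_subset_of_nonneg sdiff_subset fun A hA _ => hq A (hEF hA)).trans (hdepth x)
    have h4 : (∑ S ∈ F.powerset, if S ∩ E = {e.1, e.2} then π S else 0) ≤
        ∑ S ∈ F.powerset, if e ∈ Del S then π S else 0 := by
      refine sum_le_sum fun S hS => ?_
      have hSF := mem_powerset.1 hS
      by_cases h : S ∩ E = {e.1, e.2}
      · have hmem : e ∈ Del S := by
          have hsub : ∀ A ∈ ({e.1, e.2} : Finset (Set X)), A ∈ S := fun A hA =>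
            (mem_inter.1 (h ▸ hA)).1
          refine mem_filter.2 ⟨mem_offDiag.2 ⟨hsub _ (by simp), hsub _ (by simp), hab⟩, x, ?_⟩
          rw [← h, hE]
          ext A
          simp only [mem_filter, mem_inter]
          exact ⟨fun h => ⟨h.1, hSF h.1, h.2⟩, fun h => ⟨h.1, h.2.2⟩⟩
        rw [if_pos h, if_pos hmem]
      · rw [if_neg h]
        split_ifs
        · exact hπ S hS
        · exact le_rfl
    have h5 : 0 ≤ q e.1 * q e.2 := mul_nonneg (hq _ ha) (hq _ hb)
    have h6 := mul_le_mul_of_nonneg_left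
      (show 1 / 2 ≤ ∏ A ∈ E \ {e.1, e.2}, (1 - q A) by linarith) h5
    have h7 : q e.1 * q e.2 * ∏ A ∈ E \ {e.1, e.2}, (1 - q A) ≤
      ∑ S ∈ F.powerset, if e ∈ Del S then π S else 0 := h1.symm.trans_le h4
    linarith
  have hcard : ∑ S ∈ F.powerset, π S * S.card = ∑ A ∈ F, q A := by
    calc ∑ S ∈ F.powerset, π S * S.card
        = ∑ S ∈ F.powerset, ∑ A ∈ F, if S ∩ {A} = {A} then π S else 0 := by
          refine sum_congr rfl fun S hS => ?_
          rw [← sum_filter, sum_const, nsmul_eq_mul, mul_comm]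
          congr 3
          ext A
          have hA : A ∈ S → A ∈ F := fun h => mem_powerset.1 hS h
          simp only [mem_filter, inter_eq_right, singleton_subset_iff]
          tauto
      _ = ∑ A ∈ F, q A := by
          rw [sum_comm]
          refine sum_congr rfl fun A hA => ?_
          have := sum_powerset_inter_eq q (singleton_subset_iff.2 hA) (Subset.refl {A})
          simpa using this
  calc _ ≤ ∑ e ∈ F.offDiag with (e.1 ∩ e.2).Nonempty,
        2 * ∑ S ∈ F.powerset, (if e ∈ Del S then π S else 0) := sum_le_sum hpair
    _ = 2 * ∑ S ∈ F.powerset, ∑ e ∈ F.offDiag with (e.1 ∩ e.2).Nonempty,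
        (if e ∈ Del S then π S else 0) := by rw [← mul_sum, sum_comm]
    _ ≤ 2 * ∑ S ∈ F.powerset, π S * (2 * c * S.card) := by
        refine mul_le_mul_of_nonneg_left (sum_le_sum fun S hS => ?_) two_pos.le
        rw [← sum_filter, sum_const, nsmul_eq_mul, mul_comm]
        refine mul_le_mul_of_nonneg_left ?_ (hπ S hS)
        refine le_trans ?_ (card_delaunay_pairs_le hF (mem_powerset.1 hS))
        exact_mod_cast card_le_card fun e he => (mem_filter.1 he).2
    _ = 4 * c * ∑ A ∈ F, q A := by
        rw [← hcard, mul_sum, mul_sum]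
        exact sum_congr rfl fun S _ => by ring

open Finset in
open scoped Classical in
/-- Under the `(p, 2)`-property, every weighting of `F` has a point whose depth is at least a
`1 / ((8 * c + 1) * p)` fraction of the total weight. -/
theorem exists_deep_point {X : Type*} [Nonempty X] {F : Finset (Set X)} {c : ℝ} (hc : 0 < c)
    (hF : (dualHypergraph F).HasHereditarilyLinearDelaunay c) (hne : ∀ A ∈ F, A.Nonempty)
    {p : ℕ} (hp : 2 ≤ p) (hpq : HasPQProperty F p 2) {w : Set X → ℝ} (hw : ∀ A ∈ F, 0 ≤ w A) :
    ∃ x, ∑ A ∈ F, w A ≤ (8 * c + 1) * p * ∑ A ∈ F with x ∈ A, w A := by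
  by_contra hcon
  push Not at hcon
  set W := ∑ A ∈ F, w A with hW
  set K := (8 * c + 1) * p with hK
  have hp0 : (0 : ℝ) < p := by exact_mod_cast (by lia : 0 < p)
  have hK0 : 0 < K := by positivity
  have hW0 : 0 < W := by
    obtain ⟨x⟩ := ‹Nonempty X›
    refine lt_of_le_of_lt (mul_nonneg hK0.le (sum_nonneg fun A hA => ?_)) (hcon x)
    exact hw A (mem_filter.1 hA).1
  -- This scaling turns depth below W / K into depth below 1/2 and makes the total K / 2.
  set q : Set X → ℝ := fun A => K / (2 * W) * w A with hqdef
  have hlam : 0 ≤ K / (2 * W) := by positivity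
  have hq : ∀ A ∈ F, 0 ≤ q A := fun A hA => mul_nonneg hlam (hw A hA)
  have hdepth : ∀ x, ∑ A ∈ F with x ∈ A, q A ≤ 1 / 2 := by
    intro x
    rw [hqdef, ← mul_sum, div_mul_eq_mul_div, div_le_iff₀ (by positivity)]
    linarith [hcon x]
  have hsum : ∑ A ∈ F, q A = K / 2 := by
    rw [hqdef, ← mul_sum, ← hW]
    field_simp
  have hq2 : ∀ A ∈ F, q A ≤ 1 / 2 := by
    intro A hA
    obtain ⟨x, hx⟩ := hne A hA
    have h1 := single_le_sum (f := q) (s := F.filter fun A => x ∈ A)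
      (fun B hB => hq B (mem_filter.1 hB).1) (mem_filter.2 ⟨hA, hx⟩)
    linarith [hdepth x]
  have hmeet := sum_meeting_pairs_le hF hne hq hdepth
  obtain ⟨k, rfl⟩ : ∃ k, p = k + 1 := ⟨p - 1, by lia⟩
  -- Working on the subtype makes meeting reflexive, since members of `F` are nonempty. Here k = p -
  -- 1.
  have hT := sq_sum_le_mul_sum_related (r := fun A B : F => (A.1 ∩ B.1).Nonempty)
    (w := fun A : F => q A) (fun A => by simpa using hne A.1 A.2)
    (fun A B h => by rwa [Set.inter_comm]) k univ (fun A _ => hq A A.2) (fun G _ hG => by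
      obtain ⟨I, hI, hI2, x, hx⟩ := hpq (G.map (Function.Embedding.subtype _))
        (fun A hA => by
          obtain ⟨B, -, rfl⟩ := mem_map.1 hA
          exact B.2) (by rw [card_map, hG])
      obtain ⟨A, B, hAB, rfl⟩ := card_eq_two.1 hI2
      obtain ⟨A, hA, rfl⟩ := mem_map.1 (hI (mem_insert_self A {B}))
      obtain ⟨B, hB, rfl⟩ := mem_map.1 (hI (mem_insert_of_mem (mem_singleton_self B)))
      exact ⟨A, hA, B, hB, fun h => hAB (by rw [h]), x, hx _ (by simp), hx _ (by simp)⟩)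
  have hQ : ∑ A : F, q A * ∑ B : F with (A.1 ∩ B.1).Nonempty, q B =
      ∑ A ∈ F, q A * q A + ∑ e ∈ F.offDiag with (e.1 ∩ e.2).Nonempty, q e.1 * q e.2 := by
    have h1 : ∀ A : F, ∑ B : F with (A.1 ∩ B.1).Nonempty, q B =
        ∑ B ∈ F, if (A.1 ∩ B).Nonempty then q B else 0 := by
      intro A
      rw [sum_filter]
      exact sum_coe_sort F fun B => if (A.1 ∩ B).Nonempty then q B else 0
    simp_rw [h1]
    rw [sum_coe_sort F fun A => q A * ∑ B ∈ F, if (A ∩ B).Nonempty then q B else 0]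
    simp_rw [mul_sum, mul_ite, mul_zero]
    rw [← sum_product' F F fun A B => if (A ∩ B).Nonempty then q A * q B else 0,
      ← diag_union_offDiag, sum_union (disjoint_diag_offDiag F), sum_filter]
    congr 1
    rw [sum_diag]
    exact sum_congr rfl fun A hA => by rw [Set.inter_self, if_pos (hne A hA)]
  have hdiag : ∑ A ∈ F, q A * q A ≤ 1 / 2 * ∑ A ∈ F, q A := by
    rw [mul_sum]
    exact sum_le_sum fun A hA => mul_le_mul_of_nonneg_right (hq2 A hA) (hq A hA)
  rw [hQ, sum_coe_sort F q, hsum] at hT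
  rw [hsum] at hmeet hdiag
  -- The diagonal gives at most K/4 and the meeting pairs at most 4c · K/2, in total (8c + 1)K/4.
  have h1 : (K / 2) ^ 2 ≤ k * ((8 * c + 1) * (K / 4)) :=
    hT.trans (mul_le_mul_of_nonneg_left (by linarith) (Nat.cast_nonneg k))
  have h2 : K ≤ k * (8 * c + 1) := by
    by_contra h
    push Not at h
    nlinarith
  rw [hK] at h2
  push_cast at h2
  linarith

/-! ### Bounded VC-dimension -/

open Finset in
open scoped Classical in
/-- A set of points shattered by the regions is small: `2 ^ n` shattered points give `n` regions
whose Delaunay graph is complete. -/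
theorem card_lt_of_shatters {X : Type*} {F : Finset (Set X)} {c : ℝ}
    (hF : (dualHypergraph F).HasHereditarilyLinearDelaunay c) {P : Finset X} {n : ℕ}
    (hn : 2 * c + 1 < n) (hn0 : 0 < n) {s : Finset P}
    (hs : (F.image fun A => univ.filter fun x : P => x.1 ∈ A).Shatters s) : s.card < 2 ^ n := by
  by_contra hlt
  push Not at hlt
  -- Shattered points are indexed by the subsets of `Fin n`; region j is to contain exactly those
  -- whose index contains j.
  obtain ⟨f⟩ : Nonempty (Finset (Fin n) ↪ s) := by
    apply Function.Embedding.nonempty_of_card_le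
    simpa using hlt
  have hex : ∀ j : Fin n, ∃ A ∈ F, ∀ t : Finset (Fin n), (f t).1.1 ∈ A ↔ j ∈ t := by
    intro j
    obtain ⟨u, hu, hst⟩ := hs (t := (univ.filter fun t : Finset (Fin n) => j ∈ t).image
      fun t => (f t).1) (by
        intro y hy
        obtain ⟨t, -, rfl⟩ := mem_image.1 hy
        exact (f t).2)
    obtain ⟨A, hA, rfl⟩ := mem_image.1 hu
    refine ⟨A, hA, fun t => ?_⟩
    have := Finset.ext_iff.1 hst (f t).1
    simp only [mem_inter, mem_filter, mem_univ, true_and, mem_image, (f t).2] at this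
    rw [this]
    constructor
    · rintro ⟨t', ht', h⟩
      rwa [← f.injective (Subtype.ext h)]
    · exact fun h => ⟨t, h, rfl⟩
  choose A hAF hA using hex
  have hinj : Function.Injective A := by
    intro i j hij
    have h1 := (hA i {i}).2 (mem_singleton_self i)
    rw [hij, hA j] at h1
    exact (mem_singleton.1 h1).symm
  set S := univ.image A with hS
  have hScard : S.card = n := by
    rw [hS, card_image_of_injective _ hinj, card_univ, Fintype.card_fin]
  have hall : S.offDiag.filter (fun e => ∃ x, (S.filter fun A => x ∈ A) = {e.1, e.2}) =
      S.offDiag := by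
    refine filter_true_of_mem fun e he => ?_
    obtain ⟨h1, h2, -⟩ := mem_offDiag.1 he
    obtain ⟨i, -, hi⟩ := mem_image.1 h1
    obtain ⟨j, -, hj⟩ := mem_image.1 h2
    -- The point indexed by {i, j} lies in the regions i and j and in no other.
    refine ⟨(f {i, j}).1.1, ?_⟩
    rw [← hi, ← hj]
    ext B
    simp only [hS, mem_filter, mem_image, mem_univ, true_and, mem_insert, mem_singleton]
    constructor
    · rintro ⟨⟨l, rfl⟩, h⟩
      rw [hA] at h
      rcases mem_insert.1 h with rfl | h
      · exact Or.inl rfl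
      · rw [mem_singleton.1 h]
        exact Or.inr rfl
    · rintro (rfl | rfl)
      · exact ⟨⟨i, rfl⟩, (hA _ _).2 (by simp)⟩
      · exact ⟨⟨j, rfl⟩, (hA _ _).2 (by simp)⟩
  have h := card_delaunay_pairs_le hF (S := S) (fun B hB => by
    obtain ⟨j, -, rfl⟩ := mem_image.1 hB
    exact hAF j)
  -- This reads n(n - 1) ≤ 2cn, against n > 2c + 1.
  rw [hall, offDiag_card, hScard, Nat.cast_sub (Nat.le_mul_self n), Nat.cast_mul] at h
  have hn' : (0 : ℝ) < n := by exact_mod_cast hn0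
  nlinarith

/-! ### Choice of sample size -/

/-- Parameters for the `ε`-net theorem with `ε = 1 / (a * p)`, of sample size `O(p * log p)`. -/
theorem exists_net_parameters (a D : ℕ) (ha : 0 < a) :
    ∃ C : ℝ, 0 < C ∧ ∀ p : ℕ, 2 ≤ p → ∃ m k : ℕ,
      2 * (2 ^ k * (1 - (1 / (a * p : ℝ)) / 2) ^ m) ≤ 1 ∧ 2 * (2 * m + 1) ^ D < 2 ^ k ∧
      (m : ℝ) ≤ C * (p * Real.log p) := by
  obtain ⟨K, hK0, hK⟩ : ∃ K : ℕ, 0 < K ∧ 4 * (96 * a * K) ^ D ≤ 2 ^ K := by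
    have h := tendsto_pow_const_div_const_pow_of_one_lt D (r := (2 : ℝ)) one_lt_two
    have h4 : (0 : ℝ) < 1 / (4 * (96 * a) ^ D) := by positivity
    obtain ⟨K, h1, h2⟩ :=
      ((h.eventually (gt_mem_nhds h4)).and (Filter.eventually_gt_atTop 0)).exists
    refine ⟨K, h2, ?_⟩
    rw [div_lt_div_iff₀ (by positivity) (by positivity)] at h1
    have : (4 * (96 * a * K) ^ D : ℝ) ≤ 2 ^ K := by
      rw [mul_pow]
      linarith
    exact_mod_cast this
  have hlog2 : 0 < Real.log 2 := Real.log_pos one_lt_two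
  refine ⟨16 * a * K / Real.log 2, by positivity, fun p hp => ?_⟩
  set L := Nat.log 2 p + 1 with hL
  have hL1 : 1 ≤ L := by lia
  have hpL : p ≤ 2 ^ L := (Nat.lt_pow_succ_log_self one_lt_two p).le
  have hLL : L ≤ 2 ^ L := Nat.lt_two_pow_self.le
  have hp0 : (0 : ℝ) < p := by exact_mod_cast (by lia : 0 < p)
  have ha0 : (0 : ℝ) < a := by exact_mod_cast ha
  -- With this m, (1 - ε/2)^m ≤ exp(-4KL) ≤ 4^(-k). As p and L are at most 2^L, also 2m + 1 ≤
  -- (96aK)^L, and the choice of K absorbs its D-th power.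
  refine ⟨8 * a * K * p * L, K * L, ?_, ?_, ?_⟩
  · have hk1 : K * L ≠ 0 := by positivity
    have h1 : (1 - (1 / (a * p : ℝ)) / 2) ^ (8 * a * K * p * L) ≤ (1 / 4) ^ (K * L) := by
      have hap : (1 : ℝ) ≤ a * p := by
        exact_mod_cast Nat.mul_pos ha (by lia : 0 < p)
      have h2 : 1 / (a * p : ℝ) ≤ 1 := by
        rw [div_le_one (by positivity)]
        exact hap
      calc (1 - (1 / (a * p : ℝ)) / 2) ^ (8 * a * K * p * L)
          ≤ Real.exp (-((1 / (a * p : ℝ)) / 2)) ^ (8 * a * K * p * L) :=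
            pow_le_pow_left₀ (by linarith) (Real.one_sub_le_exp_neg _) _
        _ = Real.exp (-4) ^ (K * L) := by
            rw [← Real.exp_nat_mul, ← Real.exp_nat_mul]
            congr 1
            push_cast
            field_simp
            norm_num
        _ ≤ (1 / 4) ^ (K * L) := by
            refine pow_le_pow_left₀ (Real.exp_pos _).le ?_ _
            rw [Real.exp_neg, one_div]
            refine inv_anti₀ (by norm_num) ?_
            linarith [Real.add_one_le_exp (4 : ℝ)]
    calc 2 * ((2 : ℝ) ^ (K * L) * (1 - (1 / (a * p : ℝ)) / 2) ^ (8 * a * K * p * L))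
        ≤ 2 * (2 ^ (K * L) * (1 / 4) ^ (K * L)) := by gcongr
      _ = 2 * (1 / 2) ^ (K * L) := by rw [← mul_pow]; norm_num
      _ ≤ 2 * (1 / 2) ^ 1 := by
          refine mul_le_mul_of_nonneg_left ?_ two_pos.le
          exact pow_le_pow_of_le_one (by norm_num) (by norm_num) (Nat.one_le_iff_ne_zero.2 hk1)
      _ = 1 := by norm_num
  · have hpos : 0 < 96 * a * K := by positivity
    have h1 : 2 * (8 * a * K * p * L) + 1 ≤ (96 * a * K) ^ L := by
      have hm : 0 < 8 * a * K * p * L := by positivity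
      calc 2 * (8 * a * K * p * L) + 1 ≤ 24 * a * K * (p * L) := by nlinarith
        _ ≤ 24 * a * K * (2 ^ L * 2 ^ L) := by gcongr
        _ = (24 * a * K) * 4 ^ L := by rw [← mul_pow]; norm_num
        _ ≤ (24 * a * K) ^ L * 4 ^ L :=
          Nat.mul_le_mul_right _ (Nat.le_self_pow (by lia) _)
        _ = (96 * a * K) ^ L := by rw [← mul_pow]; ring_nf
    have hz : 0 < ((96 * a * K) ^ D) ^ L := by positivity
    calc 2 * (2 * (8 * a * K * p * L) + 1) ^ D ≤ 2 * ((96 * a * K) ^ L) ^ D := by gcongr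
      _ = 2 * ((96 * a * K) ^ D) ^ L := by rw [← pow_mul, ← pow_mul, mul_comm L]
      _ < 4 * ((96 * a * K) ^ D) ^ L := by lia
      _ ≤ 4 ^ L * ((96 * a * K) ^ D) ^ L :=
          Nat.mul_le_mul_right _ (Nat.le_self_pow (by lia) _)
      _ = (4 * (96 * a * K) ^ D) ^ L := (mul_pow _ _ _).symm
      _ ≤ (2 ^ K) ^ L := by gcongr
      _ = 2 ^ (K * L) := by rw [pow_mul]
  · have h1 : (L : ℝ) * Real.log 2 ≤ 2 * Real.log p := by
      have h2 : (Nat.log 2 p : ℝ) * Real.log 2 ≤ Real.log p := by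
        rw [← Real.log_pow]
        refine Real.log_le_log (by positivity) ?_
        exact_mod_cast Nat.pow_log_le_self 2 (by lia)
      have h3 : Real.log 2 ≤ Real.log p :=
        Real.log_le_log two_pos (by exact_mod_cast hp)
      rw [hL]
      push_cast
      linarith
    push_cast
    rw [div_mul_eq_mul_div, le_div_iff₀ hlog2]
    calc 8 * a * K * p * L * Real.log 2 = 8 * a * K * p * (L * Real.log 2) := by ring
      _ ≤ 8 * a * K * p * (2 * Real.log p) := by gcongr
      _ = 16 * a * K * (p * Real.log p) := by ring

/-! ### From fractional to finite transversals -/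

open Finset in
open scoped Classical in
/-- A finite family of subsets of `X` has the same dual hypergraph on some finite set of points. -/
theorem exists_finset_points {X : Type*} [Nonempty X] (F : Finset (Set X)) :
    ∃ P : Finset X, P.Nonempty ∧ ∀ x, ∃ y ∈ P, ∀ A ∈ F, y ∈ A ↔ x ∈ A := by
  let e : X → Finset (Set X) := fun x => F.filter fun A => x ∈ A
  -- One representative is taken for each realised membership pattern; for the other patterns
  -- `Function.invFun` returns a harmless arbitrary point.
  refine ⟨F.powerset.image (Function.invFun e), ⟨_, mem_image_of_mem _ (empty_mem_powerset F)⟩,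
    fun x => ⟨_, mem_image_of_mem _ (mem_powerset.2 (filter_subset (fun A => x ∈ A) F)), ?_⟩⟩
  intro A hA
  have h := Finset.ext_iff.1 (Function.invFun_eq (f := e) ⟨x, rfl⟩) A
  simpa only [e, mem_filter, hA, true_and] using h

open Finset in
open scoped Classical in
/-- Under the `(p, 2)`-property some probability distribution on finitely many points gives mass
at least `δ` to every member of `F`. -/
theorem exists_fractional_transversal {X : Type*} [Nonempty X] {F : Finset (Set X)} {c : ℝ}
    (hc : 0 < c) (hF : (dualHypergraph F).HasHereditarilyLinearDelaunay c)
    (hne : ∀ A ∈ F, A.Nonempty) {p : ℕ} (hp : 2 ≤ p) (hpq : HasPQProperty F p 2) {δ : ℝ}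
    (hδ : (8 * c + 1) * p * δ ≤ 1) :
    ∃ P : Finset X, ∃ μ ∈ stdSimplex ℝ P,
      ∀ A ∈ F, δ ≤ ∑ x ∈ univ.filter (fun x : P => x.1 ∈ A), μ x := by
  obtain ⟨P, hPne, hP⟩ := exists_finset_points F
  have hp0 : (0 : ℝ) < p := by exact_mod_cast (by lia : 0 < p)
  have key : ∀ w : F → ℝ, (∀ A, 0 ≤ w A) → ∃ x : P,
      δ * ∑ A, w A ≤ ∑ A, w A * (if x.1 ∈ A.1 then (1 : ℝ) else 0) := by
    intro w hw
    let w' : Set X → ℝ := fun A => if h : A ∈ F then w ⟨A, h⟩ else 0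
    have hw' : ∀ A : F, w' A = w A := fun A => dif_pos A.2
    have hw0 : ∀ A ∈ F, 0 ≤ w' A := fun A hA => (hw' ⟨A, hA⟩).ge.trans' (hw _)
    obtain ⟨x, hx⟩ := exists_deep_point hc hF hne hp hpq hw0
    obtain ⟨y, hyP, hy⟩ := hP x
    refine ⟨⟨y, hyP⟩, ?_⟩
    have h1 : ∑ A : F, w A = ∑ A ∈ F, w' A := by
      rw [← sum_coe_sort F w']
      exact sum_congr rfl fun A _ => (hw' A).symm
    have h2 : ∑ A : F, w A * (if y ∈ A.1 then (1 : ℝ) else 0) = ∑ A ∈ F with x ∈ A, w' A := by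
      rw [sum_filter, ← sum_coe_sort F fun A => if x ∈ A then w' A else 0]
      refine sum_congr rfl fun A _ => ?_
      rw [hw', mul_ite, mul_one, mul_zero]
      exact if_congr (hy A A.2) rfl rfl
    have h0 : 0 ≤ ∑ A ∈ F with x ∈ A, w' A :=
      sum_nonneg fun A hA => hw0 A (mem_filter.1 hA).1
    rw [h1, h2]
    -- Scaling the deep-point inequality by δ needs δ ≥ 0; a negative δ is trivial.
    rcases le_total δ 0 with hδ0 | hδ0
    · exact (mul_nonpos_of_nonpos_of_nonneg hδ0 (sum_nonneg hw0)).trans h0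
    · calc δ * ∑ A ∈ F, w' A ≤ δ * ((8 * c + 1) * p * ∑ A ∈ F with x ∈ A, w' A) := by gcongr
        _ = (8 * c + 1) * p * δ * ∑ A ∈ F with x ∈ A, w' A := by ring
        _ ≤ _ := mul_le_of_le_one_left h0 hδ
  obtain ⟨μ, hμ, h⟩ := exists_stdSimplex_forall_le
    (fun (x : P) (A : F) => if x.1 ∈ A.1 then (1 : ℝ) else 0) δ key
  refine ⟨P, μ, hμ, fun A hA => ?_⟩
  simpa [sum_filter] using h ⟨A, hA⟩

/-- A `(p, 2)`-theorem for families in an arbitrary space, with a bound depending only on `c`. -/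
theorem exists_transversal_card_le (c : ℝ) (hc : 0 < c) :
    ∃ C : ℝ, 0 < C ∧ ∀ {X : Type*} [Nonempty X] (F : Finset (Set X)), (∀ A ∈ F, A.Nonempty) →
      (dualHypergraph F).HasHereditarilyLinearDelaunay c → ∀ p : ℕ, 2 ≤ p → HasPQProperty F p 2 →
        ∃ Q : Finset X, IsTransversal Q F ∧ (Q.card : ℝ) ≤ C * ((p : ℝ) * Real.log (p : ℝ)) := by
  classical
  obtain ⟨n, hn⟩ := exists_nat_gt (2 * c + 1)
  have hn0 : 0 < n := by
    have : (0 : ℝ) < n := by linarith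
    exact_mod_cast this
  obtain ⟨a, ha⟩ := exists_nat_gt (8 * c + 1)
  have ha0' : (0 : ℝ) < a := by linarith
  have ha0 : 0 < a := by exact_mod_cast ha0'
  obtain ⟨C, hC, hpar⟩ := exists_net_parameters a (2 ^ n) ha0
  refine ⟨C, hC, fun {X} _ F hne hF p hp hpq => ?_⟩
  have hp0 : (0 : ℝ) < p := by exact_mod_cast (by lia : 0 < p)
  obtain ⟨m, k, hm, hk, hmC⟩ := hpar p hp
  obtain ⟨P, μ, hμ, hδ⟩ := exists_fractional_transversal hc hF hne hp hpq
    (δ := 1 / (a * p)) (by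
      rw [mul_one_div, div_le_one (by positivity)]
      gcongr)
  obtain ⟨x, hx⟩ := exists_net_of_shatters_card_le
    (F.image fun A => Finset.univ.filter fun x : P => x.1 ∈ A)
    (fun s hs => (card_lt_of_shatters hF hn hn0 hs).le) hμ (fun A hA => by
      obtain ⟨B, hB, rfl⟩ := Finset.mem_image.1 hA
      exact hδ B hB) hm hk
  refine ⟨Finset.univ.image fun i => (x i).1, fun A hA => ?_, ?_⟩
  · obtain ⟨i, hi⟩ := hx _ (Finset.mem_image_of_mem _ hA)
    exact ⟨_, Finset.mem_image_of_mem _ (Finset.mem_univ i), (Finset.mem_filter.1 hi).2⟩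
  · refine le_trans ?_ hmC
    exact_mod_cast Finset.card_image_le.trans (by simp)

/-- Of the Euclidean space only its nonemptiness matters, so C cannot depend on d. -/
theorem theorem2 (c : ℝ) (hc : 0 < c) :
    ∃ C : ℝ, 0 < C ∧
      ∀ (d : ℕ) (F : Finset (Set (EuclideanSpace ℝ (Fin d)))),
        (∀ A ∈ F, A.Nonempty) →
        (dualHypergraph F).HasHereditarilyLinearDelaunay c →
        ∀ p : ℕ, 2 ≤ p → HasPQProperty F p 2 →
          ∃ Q : Finset (EuclideanSpace ℝ (Fin d)),
            IsTransversal Q F ∧ (Q.card : ℝ) ≤ C * ((p : ℝ) * Real.log (p : ℝ)) := by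
  obtain ⟨C, hC, h⟩ := exists_transversal_card_le c hc
  exact ⟨C, hC, fun d F => h F⟩
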